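/- Let $\mathbb D=\{z\in\mathbb C:|z|<1\}$, $\mathbb T=\{z\in\mathbb C:|z|=1\}$, and let $\rho=(r_n)_{n\ge 0}$ be an increasing sequence in $[0,1)$ with $r_n\to 1$. Denote by $\mathcal U_A(\mathbb D,\rho)$ the set of all holomorphic functions $f$ on $\mathbb D$ such that for every compact set $K\subset\mathbb T$ with $K\neq\mathbb T$ and every continuous function $\varphi:K\to\mathbb C$ there is a strictly increasing sequence $(n_k)$ of non-negative integers with $\sup_{z\in K}|f(r_{n_k}z)-\varphi(z)|\to 0$ as $k\to\infty$. **Theorem.** Let $w:[0,1)\to[1,\infty)$ be continuous and increasing, with $w(r)\to\infty$ as $r\to 1$. For every set $A\subset\mathbb D$ such that $\overline A\cap\mathbb T$ contains exactly one point, there exists $f\in\mathcal U_A(\mathbb D,\rho)$ such that $|f(z)|\le w(|z|)$ for all $z\in A$. (Here "increasing" for $\rho$ and $w$ may be read as non-decreasing.) -/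

import Mathlib

open Set Filter Topology Metric

/-- The set `U_A(𝔻, ρ)` of Abel universal functions with respect to the sequence of radii
`ρ = (r_n)`: functions `f` holomorphic on the open unit disc such that, for every compact
`K ⊆ 𝕋` with `K ≠ 𝕋` and every `φ ∈ C(K)`, some subsequence of the dilates
`z ↦ f (r_n z)` converges to `φ` uniformly on `K`.
A holomorphic function on the disc is represented by a function `ℂ → ℂ`, whose values outside
the disc are irrelevant; likewise `φ ∈ C(K)` by a function on `ℂ` that is continuous on `K`. -/
def AbelUniversal (r : ℕ → ℝ) : Set (ℂ → ℂ) :=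
  {f | DifferentiableOn ℂ f (ball (0 : ℂ) 1) ∧
    ∀ K : Set ℂ, IsCompact K → K ⊆ sphere (0 : ℂ) 1 → K ≠ sphere (0 : ℂ) 1 →
      ∀ φ : ℂ → ℂ, ContinuousOn φ K →
        ∃ n : ℕ → ℕ, StrictMono n ∧
          TendstoUniformlyOn (fun (k : ℕ) (z : ℂ) => f ((r (n k) : ℂ) * z)) φ atTop K}

/-! `f` is a limit of polynomials `S` on the disc, each obtained from the previous one by adding a
correction `p`. The correction is tiny on a disc `‖z‖ ≤ ρ`, brings the dilate by some `r n'` close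
to a prescribed function off a small arc of the circle, and is bounded on `A` by a constant `M` that
does not depend on `ρ` or on the dilation. Since `w` tends to infinity, `ρ` can be taken so close to
1 that `w` exceeds `sup ‖S‖ + M` beyond `ρ`; inside `ρ` the correction only uses up a little of the
slack left under `w`. A countable dense family of targets and gap points is treated with infinite
repetition, the gaps shrinking (`exists_dense_circle_data`, `exists_poly_step`).

For a target `g`, write `g = Q + h` with `Q z = g ζ * (conj ζ * z) ^ m`: `Q` is bounded by `‖g ζ‖`
on the disc and tiny on smaller discs, while `h` vanishes at `ζ`, so it is close to some `ψ` that
vanishes near `ζ`. Near the circle `A` lies in a thin cone about the ray through `ζ`. It remains to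
find a polynomial close to `ψ` on the circle minus an arc and small on a smaller disc and on the
cone (`exists_poly_approx_of_eq_zero_near`).

A discretised Poisson integral of `ψ` does this as a rational function: it is close to `ψ` on the
circle and to 0 away from the support of `ψ`. Its poles `t / q` and `q * t` are then pushed to
infinity off the compact set: the outer ones radially, the inner ones through the removed arc. -/

/-- `f` is a uniform limit of polynomials on `E`. -/
def PolyApprox (E : Set ℂ) (f : ℂ → ℂ) : Prop :=
  ∀ ε > 0, ∃ p : Polynomial ℂ, ∀ z ∈ E, ‖p.eval z - f z‖ ≤ ε

/-! ### Polynomial approximability and pole pushing -/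

namespace PolyApprox

variable {E : Set ℂ} {f g : ℂ → ℂ}

theorem add (hf : PolyApprox E f) (hg : PolyApprox E g) : PolyApprox E (fun z => f z + g z) := by
  intro ε hε
  obtain ⟨p, hp⟩ := hf (ε / 2) (half_pos hε)
  obtain ⟨p', hp'⟩ := hg (ε / 2) (half_pos hε)
  refine ⟨p + p', fun z hz => ?_⟩
  have h : (p + p').eval z - (f z + g z) = (p.eval z - f z) + (p'.eval z - g z) := by
    rw [Polynomial.eval_add]; ring
  rw [h]
  linarith [norm_add_le (p.eval z - f z) (p'.eval z - g z), hp z hz, hp' z hz]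

theorem const_mul (hf : PolyApprox E f) (c : ℂ) : PolyApprox E (fun z => c * f z) := by
  intro ε hε
  have hc : 0 < ‖c‖ + 1 := by positivity
  obtain ⟨p, hp⟩ := hf (ε / (‖c‖ + 1)) (by positivity)
  refine ⟨Polynomial.C c * p, fun z hz => ?_⟩
  rw [Polynomial.eval_mul, Polynomial.eval_C, ← mul_sub, norm_mul]
  calc ‖c‖ * ‖p.eval z - f z‖ ≤ (‖c‖ + 1) * (ε / (‖c‖ + 1)) := by
        gcongr
        · linarith
        · exact hp z hz
    _ = ε := by field_simp

theorem sum {ι : Type*} (s : Finset ι) {F : ι → ℂ → ℂ} (h : ∀ i ∈ s, PolyApprox E (F i)) :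
    PolyApprox E (fun z => ∑ i ∈ s, F i z) := by
  classical
  induction s using Finset.induction_on with
  | empty => exact fun ε hε => ⟨0, fun z _ => by simpa using hε.le⟩
  | insert a s ha ih =>
    simp only [Finset.sum_insert ha]
    exact (h a (Finset.mem_insert_self a s)).add
      (ih fun i hi => h i (Finset.mem_insert_of_mem hi))

/-- Pole pushing: if `a` can be joined to infinity off the compact set `E`, then `1 / (a - z)` is a
uniform limit of polynomials on `E`. -/
theorem inv_sub (hE : IsCompact E) {V : Set ℂ} (hV : IsPreconnected V) (hVE : Disjoint V E)
    (hVb : ¬ Bornology.IsBounded V) {a : ℂ} (ha : a ∈ V) :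
    PolyApprox E (fun z => (a - z)⁻¹) := by
  have : CompactSpace E := isCompact_iff_compactSpace.mp hE
  set S : Subalgebra ℂ C(E, ℂ) := (polynomialFunctions E).topologicalClosure with hS
  have : IsClosed (S : Set C(E, ℂ)) := Subalgebra.isClosed_topologicalClosure _
  have hXS : (Polynomial.toContinuousMapOnAlgHom E Polynomial.X) ∈ S :=
    Subalgebra.le_topologicalClosure _ (by
      rw [← SetLike.mem_coe, polynomialFunctions_coe]; exact mem_range_self _)
  set x : S := ⟨_, hXS⟩ with hx
  have hspec : spectrum ℂ (x : C(E, ℂ)) = E := by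
    rw [ContinuousMap.spectrum_eq_range]
    ext z
    simp [hx]
  -- Passing to the closed subalgebra `S` can only fill bounded components of the complement of the
  -- spectrum `E`; the component of `a` contains the unbounded set `V`. Hence `a - x` is invertible
  -- within the closure of the polynomials.
  have hnot : a ∉ spectrum ℂ x := by
    intro h
    have hb := Subalgebra.spectrum_isBounded_connectedComponentIn S x h
    rw [hspec] at hb
    exact hVb (hb.subset (hV.subset_connectedComponentIn ha hVE.subset_compl_right))
  rw [spectrum.notMem_iff] at hnot
  obtain ⟨y, hy⟩ := hnot.exists_right_inv
  have hinv : ∀ z : E, (a - z)⁻¹ = (y : C(E, ℂ)) z := by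
    intro z
    have h1 := congrArg (fun s : S => (s : C(E, ℂ)) z) hy
    simp [hx] at h1
    exact inv_eq_of_mul_eq_one_right h1
  intro ε hε
  have hyS : (y : C(E, ℂ)) ∈ closure (polynomialFunctions E : Set C(E, ℂ)) := y.2
  rw [Metric.mem_closure_iff] at hyS
  obtain ⟨b, hb, hyb⟩ := hyS ε hε
  rw [polynomialFunctions_coe] at hb
  obtain ⟨p, rfl⟩ := hb
  refine ⟨p, fun z hz => ?_⟩
  have h2 := (ContinuousMap.dist_apply_le_dist (f := (y : C(E, ℂ)))
    (g := Polynomial.toContinuousMapOnAlgHom E p) ⟨z, hz⟩).trans hyb.le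
  rw [dist_comm, dist_eq_norm, ← hinv] at h2
  simpa using h2

end PolyApprox

/-! ### Discretised Poisson integrals -/

/-- The Poisson kernel of the unit circle at radius `q`, continued to a rational function of `u`
with poles at `t / q` and `q * t`. -/
noncomputable def ratPoisson (q : ℝ) (t u : ℂ) : ℂ :=
  t / q * (t / q - u)⁻¹ - q * t * (q * t - u)⁻¹

theorem ratPoisson_eq {q : ℝ} (hq : 0 < q) {t u : ℂ} (h1 : t - q * u ≠ 0) (h2 : u - q * t ≠ 0) :
    ratPoisson q t u = (1 - q ^ 2) * (t * u) / ((t - q * u) * (u - q * t)) := by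
  have hq' : (q : ℂ) ≠ 0 := by exact_mod_cast hq.ne'
  have h3 : t / q - u = (t - q * u) / q := by field_simp
  have h4 : q * t - u = -(u - q * t) := by ring
  have h5 : t / q * ((t - q * u) / q)⁻¹ = t / (t - q * u) := by
    rw [inv_div, div_mul_div_cancel₀ hq']
  rw [ratPoisson, h3, h4, h5, inv_neg, mul_neg, sub_neg_eq_add, ← div_eq_mul_inv,
    div_add_div _ _ h1 h2]
  congr 1
  ring

/-- The factor `1 - q ^ 2` makes the kernel tend to 0 as `q → 1` at a fixed distance from its poles,
off the circle as well as on it. -/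
theorem norm_ratPoisson_le {q c : ℝ} (hq : 0 < q) (hq1 : q < 1) (hc : 0 < c) {t u : ℂ}
    (ht : ‖t‖ = 1) (h1 : c ≤ ‖t - q * u‖) (h2 : c ≤ ‖u - q * t‖) :
    ‖ratPoisson q t u‖ ≤ (1 - q ^ 2) * ‖u‖ / c ^ 2 := by
  have h1' : t - q * u ≠ 0 := norm_pos_iff.mp (hc.trans_le h1)
  have h2' : u - q * t ≠ 0 := norm_pos_iff.mp (hc.trans_le h2)
  have hq2 : 0 ≤ 1 - q ^ 2 := by nlinarith
  have h3 : ‖(1 - (q : ℂ) ^ 2)‖ = 1 - q ^ 2 := by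
    rw [← Complex.ofReal_pow, ← Complex.ofReal_one, ← Complex.ofReal_sub, Complex.norm_real,
      Real.norm_of_nonneg hq2]
  rw [ratPoisson_eq hq h1' h2', norm_div, norm_mul, norm_mul, norm_mul, h3, ht, one_mul, sq c]
  gcongr

theorem sub_ofReal_mul_ne_zero {q : ℝ} (hq : 0 < q) (hq1 : q < 1) {t u : ℂ} (ht : ‖t‖ = 1)
    (hu : ‖u‖ = 1) : t - q * u ≠ 0 := by
  intro h
  have h1 : ‖t‖ = ‖(q : ℂ) * u‖ := by rw [sub_eq_zero.mp h]
  rw [norm_mul, ht, hu, Complex.norm_real, Real.norm_of_nonneg hq.le] at h1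
  linarith

theorem ratPoisson_of_norm_eq_one {q : ℝ} (hq : 0 < q) (hq1 : q < 1) {t u : ℂ} (ht : ‖t‖ = 1)
    (hu : ‖u‖ = 1) : ratPoisson q t u = (((1 - q ^ 2) / ‖u - q * t‖ ^ 2 : ℝ) : ℂ) := by
  have h1 := sub_ofReal_mul_ne_zero hq hq1 ht hu
  have h2 := sub_ofReal_mul_ne_zero hq hq1 hu ht
  have ht0 : t ≠ 0 := norm_ne_zero_iff.mp (by rw [ht]; exact one_ne_zero)
  have hu0 : u ≠ 0 := norm_ne_zero_iff.mp (by rw [hu]; exact one_ne_zero)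
  have hct : (starRingEnd ℂ) t = t⁻¹ := by rw [Complex.inv_eq_conj ht]
  have hcu : (starRingEnd ℂ) u = u⁻¹ := by rw [Complex.inv_eq_conj hu]
  have h3 : ((‖u - q * t‖ ^ 2 : ℝ) : ℂ) = (u - q * t) * ((t - q * u) / (t * u)) := by
    rw [Complex.ofReal_pow, ← Complex.mul_conj', map_sub, map_mul, Complex.conj_ofReal, hct, hcu]
    field_simp
  rw [ratPoisson_eq hq h1 h2, Complex.ofReal_div, h3]
  push_cast
  field_simp

/-- Expand each term as a geometric sum of length `N` over the common denominator `1 - x ^ N`;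
averaging over the roots of unity kills every power except the zeroth. -/
theorem sum_inv_one_sub_mul_pow {N : ℕ} (hN : 0 < N) {ω : ℂ} (hω : IsPrimitiveRoot ω N) {x : ℂ}
    (hx : ‖x‖ < 1) :
    ∑ j ∈ Finset.range N, (1 - x * ω ^ j)⁻¹ = N * (1 - x ^ N)⁻¹ := by
  have hωn : ‖ω‖ = 1 := hω.norm'_eq_one hN.ne'
  have hterm : ∀ j, (1 - x * ω ^ j)⁻¹
      = (∑ k ∈ Finset.range N, (x * ω ^ j) ^ k) * (1 - x ^ N)⁻¹ := by
    intro j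
    have hy : ‖x * ω ^ j‖ < 1 := by simpa [hωn] using hx
    have h0 : 1 - x * ω ^ j ≠ 0 := by
      intro h
      rw [← sub_eq_zero.mp h] at hy
      simp at hy
    have hxN : 1 - x ^ N ≠ 0 := by
      intro h
      have : ‖x ^ N‖ < 1 := by
        rw [norm_pow]; exact pow_lt_one₀ (norm_nonneg _) hx hN.ne'
      rw [← sub_eq_zero.mp h] at this
      simp at this
    have hg := mul_neg_geom_sum (x * ω ^ j) N
    have hp : (x * ω ^ j) ^ N = x ^ N := by
      rw [mul_pow, ← pow_mul, mul_comm j, pow_mul, hω.pow_eq_one, one_pow, mul_one]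
    rw [hp] at hg
    field_simp
    linear_combination -hg
  simp_rw [hterm]
  rw [← Finset.sum_mul, Finset.sum_comm]
  congr 1
  have hk : ∀ k ∈ Finset.range N, k ≠ 0 → ∑ j ∈ Finset.range N, (x * ω ^ j) ^ k = 0 := by
    intro k hkN hk0
    have h1 : ω ^ k ≠ 1 := hω.pow_ne_one_of_pos_of_lt hk0 (Finset.mem_range.mp hkN)
    have h2 := mul_neg_geom_sum (ω ^ k) N
    rw [← pow_mul, mul_comm k, pow_mul, hω.pow_eq_one, one_pow, sub_self] at h2
    have h3 : ∑ j ∈ Finset.range N, (ω ^ k) ^ j = 0 :=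
      (mul_eq_zero.mp h2).resolve_left (sub_ne_zero.mpr h1.symm)
    calc ∑ j ∈ Finset.range N, (x * ω ^ j) ^ k
        = x ^ k * ∑ j ∈ Finset.range N, (ω ^ k) ^ j := by
          rw [Finset.mul_sum]
          exact Finset.sum_congr rfl fun j _ => by rw [mul_pow, ← pow_mul, ← pow_mul, mul_comm j]
      _ = 0 := by rw [h3, mul_zero]
  rw [Finset.sum_eq_single 0 hk (by simp [hN.ne'])]
  simp

theorem sum_ratPoisson {N : ℕ} (hN : 0 < N) {ω : ℂ} (hω : IsPrimitiveRoot ω N) {q : ℝ}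
    (hq : 0 < q) (hq1 : q < 1) {u : ℂ} (hu : ‖u‖ = 1) :
    ∑ j ∈ Finset.range N, ratPoisson q (ω ^ j) u
      = N * ((1 - (q * u) ^ N)⁻¹ + (1 - (q * u⁻¹) ^ N)⁻¹ - 1) := by
  have hωn : ‖ω‖ = 1 := hω.norm'_eq_one hN.ne'
  have hω0 : ω ≠ 0 := norm_ne_zero_iff.mp (by rw [hωn]; exact one_ne_zero)
  have hu0 : u ≠ 0 := norm_ne_zero_iff.mp (by rw [hu]; exact one_ne_zero)
  have hq' : (q : ℂ) ≠ 0 := by exact_mod_cast hq.ne'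
  have hqn : ‖(q : ℂ)‖ < 1 := by rwa [Complex.norm_real, Real.norm_of_nonneg hq.le]
  have hterm : ∀ j, ratPoisson q (ω ^ j) u
      = (1 - q * u * ω⁻¹ ^ j)⁻¹ + (1 - q * u⁻¹ * ω ^ j)⁻¹ - 1 := by
    intro j
    have hj : ‖ω ^ j‖ = 1 := by rw [norm_pow, hωn, one_pow]
    have hj0 : ω ^ j ≠ 0 := pow_ne_zero _ hω0
    have h1 := sub_ofReal_mul_ne_zero hq hq1 hj hu
    have h2 := sub_ofReal_mul_ne_zero hq hq1 hu hj
    have h3 : 1 - q * u * ω⁻¹ ^ j = (ω ^ j - q * u) / ω ^ j := by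
      rw [inv_pow]; field_simp
    have h4 : 1 - q * u⁻¹ * ω ^ j = (u - q * ω ^ j) / u := by field_simp
    rw [ratPoisson_eq hq h1 h2, h3, h4]
    field_simp
    ring
  simp_rw [hterm]
  rw [Finset.sum_sub_distrib, Finset.sum_add_distrib,
    sum_inv_one_sub_mul_pow hN hω.inv (by simpa [hu] using hqn),
    sum_inv_one_sub_mul_pow hN hω (by simpa [hu] using hqn)]
  simp
  ring

theorem norm_inv_one_sub_sub_one_le {x : ℂ} {s : ℝ} (hx : ‖x‖ ≤ s) (hs : s < 1) :
    ‖(1 - x)⁻¹ - 1‖ ≤ s / (1 - s) := by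
  have h1 : 1 - s ≤ ‖1 - x‖ := by
    have := norm_sub_norm_le (1 : ℂ) x
    rw [norm_one] at this
    linarith
  have h0 : 1 - x ≠ 0 := norm_pos_iff.mp (by linarith)
  have h2 : (1 - x)⁻¹ - 1 = x / (1 - x) := by field_simp; ring
  rw [h2, norm_div]
  have : 0 < 1 - s := by linarith
  gcongr
  exact (norm_nonneg x).trans hx

/-- Sampling at the `N`th roots of unity only keeps the Fourier modes divisible by `N`, so the
discrete mass differs from 1 by two tails of size `q ^ N`. -/
theorem norm_sum_ratPoisson_sub_le {N : ℕ} (hN : 0 < N) {ω : ℂ} (hω : IsPrimitiveRoot ω N) {q : ℝ}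
    (hq : 0 < q) (hq1 : q < 1) {u : ℂ} (hu : ‖u‖ = 1) :
    ‖∑ j ∈ Finset.range N, ratPoisson q (ω ^ j) u / N - 1‖ ≤ 2 * (q ^ N / (1 - q ^ N)) := by
  have hN' : (N : ℂ) ≠ 0 := by exact_mod_cast hN.ne'
  have hqN : q ^ N < 1 := pow_lt_one₀ hq.le hq1 hN.ne'
  rw [← Finset.sum_div, sum_ratPoisson hN hω hq hq1 hu, mul_div_cancel_left₀ _ hN']
  have h1 := norm_inv_one_sub_sub_one_le (x := (q * u) ^ N) (s := q ^ N)
    (by simp [hu, abs_of_pos hq]) hqN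
  have h2 := norm_inv_one_sub_sub_one_le (x := (q * u⁻¹) ^ N) (s := q ^ N)
    (by simp [hu, abs_of_pos hq]) hqN
  calc _ = ‖((1 - (q * u) ^ N)⁻¹ - 1) + ((1 - (q * u⁻¹) ^ N)⁻¹ - 1)‖ := by congr 1; ring
    _ ≤ _ := (norm_add_le _ _).trans (by linarith)

/-- Discrete Poisson integrals of `ψ` converge to `ψ` on the circle, and to `0` away from the
support of `ψ`. -/
theorem exists_sum_ratPoisson_approx {ψ : ℂ → ℂ} (hψ : ContinuousOn ψ (sphere 0 1)) {c B ε : ℝ}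
    (hc : 0 < c) (hε : 0 < ε) :
    ∀ᶠ q : ℝ in 𝓝[<] 1, ∃ (N : ℕ) (t : ℕ → ℂ), (∀ j, ‖t j‖ = 1) ∧
      (∀ u, ‖u‖ = 1 → ‖∑ j ∈ Finset.range N, ψ (t j) / N * ratPoisson q (t j) u - ψ u‖ ≤ ε) ∧
      ∀ u, ‖u‖ ≤ B → (∀ s, ‖s‖ = 1 → ψ s ≠ 0 → c ≤ ‖u - s‖) →
        ‖∑ j ∈ Finset.range N, ψ (t j) / N * ratPoisson q (t j) u‖ ≤ ε := by
  have hcpt : IsCompact (sphere (0 : ℂ) 1) := isCompact_sphere 0 1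
  obtain ⟨M₀, hM₀⟩ := hcpt.exists_bound_of_continuousOn hψ
  obtain ⟨M, hM0, hM⟩ : ∃ M : ℝ, 0 < M ∧ ∀ z, ‖z‖ = 1 → ‖ψ z‖ ≤ M :=
    ⟨max M₀ 1, by positivity, fun z hz => (hM₀ z (by simpa using hz)).trans (le_max_left _ _)⟩
  have huc := hcpt.uniformContinuousOn_of_continuous hψ
  rw [Metric.uniformContinuousOn_iff] at huc
  obtain ⟨δ, hδ, hδψ⟩ := huc (ε / 4) (by positivity)
  have hlim : ∀ k a : ℝ, 0 < a → ∀ᶠ q : ℝ in 𝓝[<] 1, (1 - q) * k < a := by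
    intro k a ha
    have : Tendsto (fun q : ℝ => (1 - q) * k) (𝓝[<] 1) (𝓝 ((1 - 1) * k)) :=
      (Continuous.tendsto (by fun_prop) 1).mono_left nhdsWithin_le_nhds
    rw [sub_self, zero_mul] at this
    exact this.eventually_lt_const ha
  have hlim2 : ∀ k a : ℝ, 0 < a → ∀ᶠ q : ℝ in 𝓝[<] 1, (1 - q ^ 2) * k < a := by
    intro k a ha
    have : Tendsto (fun q : ℝ => (1 - q ^ 2) * k) (𝓝[<] 1) (𝓝 ((1 - 1 ^ 2) * k)) :=
      (Continuous.tendsto (by fun_prop) 1).mono_left nhdsWithin_le_nhds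
    rw [one_pow, sub_self, zero_mul] at this
    exact this.eventually_lt_const ha
  -- Replacing `q * t` by `t`, or `q * u` by `u`, costs at most `1 - q` or `(1 - q) * B`, which
  -- turns the distances `δ`, `c` into `δ / 2`, `c / 2`. The last two conditions let `1 - q ^ 2`
  -- absorb the resulting fixed bounds.
  filter_upwards [self_mem_nhdsWithin, hlim 1 1 one_pos, hlim 1 (δ / 2) (half_pos hδ),
    hlim B (c / 2) (half_pos hc), hlim 1 (c / 2) (half_pos hc),
    hlim2 (2 * M / (δ / 2) ^ 2) (ε / 4) (by positivity),
    hlim2 (M * (B / (c / 2) ^ 2)) ε hε] with q hq1 hq hqδ hqB hqc hq4 hq5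
  rw [mul_one] at hq hqδ hqc
  replace hq : 0 < q := by linarith
  replace hq1 : q < 1 := hq1
  have hq2 : 0 < 1 - q ^ 2 := by nlinarith
  -- `N` is chosen after `q`. The bound 1 keeps the total mass at most 2; the bound `ε / (4 * M)`
  -- controls the mass defect multiplied by `ψ u`.
  obtain ⟨N, hN, hNη⟩ : ∃ N : ℕ, 0 < N ∧ 2 * (q ^ N / (1 - q ^ N)) ≤ min 1 (ε / (4 * M)) := by
    have h0 := tendsto_pow_atTop_nhds_zero_of_lt_one hq.le hq1
    have h1 : Tendsto (fun N : ℕ => 2 * (q ^ N / (1 - q ^ N))) atTop (𝓝 (2 * (0 / (1 - 0)))) :=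
      (h0.div (h0.const_sub 1) (by norm_num)).const_mul 2
    rw [zero_div, mul_zero] at h1
    obtain ⟨N, h2, h3⟩ := ((h1.eventually_le_const
      (show (0 : ℝ) < min 1 (ε / (4 * M)) by positivity)).and (eventually_gt_atTop 0)).exists
    exact ⟨N, h3, h2⟩
  have hN' : (0 : ℝ) < N := by exact_mod_cast hN
  have hω := Complex.isPrimitiveRoot_exp N hN.ne'
  set ω := Complex.exp (2 * Real.pi * Complex.I / N)
  have hωn : ‖ω‖ = 1 := hω.norm'_eq_one hN.ne'
  have ht : ∀ j : ℕ, ‖ω ^ j‖ = 1 := fun j => by rw [norm_pow, hωn, one_pow]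
  refine ⟨N, fun j => ω ^ j, ht, fun u hu => ?_, fun u huB hus => ?_⟩
  · set P : ℕ → ℝ := fun j => (1 - q ^ 2) / ‖u - q * ω ^ j‖ ^ 2 with hP
    have hP0 : ∀ j, 0 ≤ P j := fun j => by positivity
    have hker : ∀ j, ratPoisson q (ω ^ j) u = (P j : ℂ) := fun j =>
      ratPoisson_of_norm_eq_one hq hq1 (ht j) hu
    have hs := norm_sum_ratPoisson_sub_le hN hω hq hq1 hu
    simp_rw [hker] at hs ⊢
    have hs' : ‖∑ j ∈ Finset.range N, (P j : ℂ) / N - 1‖ ≤ min 1 (ε / (4 * M)) := hs.trans hNη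
    have hs1 : ∑ j ∈ Finset.range N, P j / N ≤ 2 := by
      have h1 : ‖((∑ j ∈ Finset.range N, P j / N - 1 : ℝ) : ℂ)‖ ≤ 1 := by
        push_cast
        exact hs'.trans (min_le_left _ _)
      rw [Complex.norm_real] at h1
      linarith [le_of_abs_le h1]
    have hdec : ∑ j ∈ Finset.range N, ψ (ω ^ j) / N * (P j : ℂ) - ψ u
        = ∑ j ∈ Finset.range N, (P j : ℂ) / N * (ψ (ω ^ j) - ψ u)
          + (∑ j ∈ Finset.range N, (P j : ℂ) / N - 1) * ψ u := by
      simp_rw [mul_sub, Finset.sum_sub_distrib, sub_mul, one_mul, Finset.sum_mul]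
      rw [sub_add_sub_cancel]
      congr 1
      exact Finset.sum_congr rfl fun j _ => by ring
    have hterm : ∀ j ∈ Finset.range N, ‖(P j : ℂ) / N * (ψ (ω ^ j) - ψ u)‖
        ≤ P j / N * (ε / 4) + ε / 4 / N := by
      intro j _
      rw [norm_mul, norm_div, Complex.norm_real, Complex.norm_natCast,
        Real.norm_of_nonneg (hP0 j)]
      by_cases hd : ‖ω ^ j - u‖ < δ
      · have h1 := hδψ (ω ^ j) (by simpa using ht j) u (by simpa using hu)
          (by rwa [dist_eq_norm])
        rw [dist_eq_norm] at h1
        have h2 : 0 ≤ ε / 4 / N := by positivity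
        have h3 : P j / N * ‖ψ (ω ^ j) - ψ u‖ ≤ P j / N * (ε / 4) :=
          mul_le_mul_of_nonneg_left h1.le (div_nonneg (hP0 j) hN'.le)
        linarith
      · have h1 : ‖ψ (ω ^ j) - ψ u‖ ≤ 2 * M := by
          linarith [norm_sub_le (ψ (ω ^ j)) (ψ u), hM _ (ht j), hM u hu]
        have h2 : δ / 2 ≤ ‖u - q * ω ^ j‖ := by
          have h3 : ω ^ j - u = (1 - q) * ω ^ j - (u - q * ω ^ j) := by ring
          have h4 : ‖((1 : ℂ) - q) * ω ^ j‖ = 1 - q := by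
            rw [norm_mul, ht, mul_one, ← Complex.ofReal_one, ← Complex.ofReal_sub,
              Complex.norm_real, Real.norm_of_nonneg (by linarith)]
          rw [h3] at hd
          linarith [norm_sub_le (((1 : ℂ) - q) * ω ^ j) (u - q * ω ^ j)]
        have h5 : P j ≤ (1 - q ^ 2) / (δ / 2) ^ 2 := by
          simp only [hP]; gcongr
        have h6 : P j / N * ‖ψ (ω ^ j) - ψ u‖ ≤ ε / 4 / N := by
          calc P j / N * ‖ψ (ω ^ j) - ψ u‖ ≤ (1 - q ^ 2) / (δ / 2) ^ 2 / N * (2 * M) := by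
                gcongr
            _ = (1 - q ^ 2) * (2 * M / (δ / 2) ^ 2) / N := by ring
            _ ≤ _ := by gcongr
        have := mul_nonneg (div_nonneg (hP0 j) hN'.le) (by positivity : 0 ≤ ε / 4)
        linarith
    rw [hdec]
    have e1 := (norm_sum_le _ _).trans (Finset.sum_le_sum hterm)
    rw [Finset.sum_add_distrib, ← Finset.sum_mul, Finset.sum_const, Finset.card_range,
      nsmul_eq_mul, mul_div_cancel₀ _ hN'.ne'] at e1
    have e2 : ‖(∑ j ∈ Finset.range N, (P j : ℂ) / N - 1) * ψ u‖ ≤ ε / 4 := by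
      rw [norm_mul]
      calc _ ≤ ε / (4 * M) * M := mul_le_mul (hs'.trans (min_le_right _ _)) (hM u hu)
            (norm_nonneg _) (by positivity)
        _ = ε / 4 := by field_simp
    have e3 : (∑ j ∈ Finset.range N, P j / N) * (ε / 4) ≤ 2 * (ε / 4) := by gcongr
    refine (norm_add_le _ _).trans ?_
    linarith
  · have hterm : ∀ j ∈ Finset.range N, ‖ψ (ω ^ j) / N * ratPoisson q (ω ^ j) u‖ ≤ ε / N := by
      intro j _
      by_cases h0 : ψ (ω ^ j) = 0
      · rw [h0]; simp; positivity
      · have h1 := hus _ (ht j) h0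
        have hn : ‖((1 : ℂ) - q)‖ = 1 - q := by
          rw [← Complex.ofReal_one, ← Complex.ofReal_sub, Complex.norm_real,
            Real.norm_of_nonneg (by linarith)]
        have h2 : c / 2 ≤ ‖ω ^ j - q * u‖ := by
          have h3 : u - ω ^ j = (1 - q) * u - (ω ^ j - q * u) := by ring
          have h4 : ‖((1 : ℂ) - q) * u‖ ≤ (1 - q) * B := by
            rw [norm_mul, hn]
            exact mul_le_mul_of_nonneg_left huB (by linarith)
          rw [h3] at h1
          linarith [norm_sub_le (((1 : ℂ) - q) * u) (ω ^ j - q * u)]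
        have h3 : c / 2 ≤ ‖u - q * ω ^ j‖ := by
          have h3 : u - ω ^ j = (u - q * ω ^ j) - (1 - q) * ω ^ j := by ring
          have h4 : ‖((1 : ℂ) - q) * ω ^ j‖ = 1 - q := by
            rw [norm_mul, hn, ht, mul_one]
          rw [h3] at h1
          linarith [norm_sub_le (u - q * ω ^ j) (((1 : ℂ) - q) * ω ^ j)]
        have h4 := norm_ratPoisson_le hq hq1 (half_pos hc) (ht j) h2 h3
        rw [norm_mul, norm_div, Complex.norm_natCast]
        calc ‖ψ (ω ^ j)‖ / N * ‖ratPoisson q (ω ^ j) u‖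
            ≤ M / N * ((1 - q ^ 2) * B / (c / 2) ^ 2) := by
              gcongr
              · exact hM _ (ht j)
              · refine h4.trans ?_
                gcongr
          _ = (1 - q ^ 2) * (M * (B / (c / 2) ^ 2)) / N := by ring
          _ ≤ ε / N := by gcongr
    refine (norm_sum_le _ _).trans ((Finset.sum_le_sum hterm).trans ?_)
    rw [Finset.sum_const, Finset.card_range, nsmul_eq_mul, mul_div_cancel₀ _ hN'.ne']

/-! ### Escape paths for the poles -/

/-- Along the shorter arc from `-ζ` to `t` the distance to `ζ` decreases, so it is least at `t`. Any
two points outside a cone about `ζ` are thus joined through `-ζ` without entering it. -/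
theorem exists_isPreconnected_arc {ζ t : ℂ} (hζ : ‖ζ‖ = 1) (ht : ‖t‖ = 1) :
    ∃ V : Set ℂ, IsPreconnected V ∧ -ζ ∈ V ∧ t ∈ V ∧
      ∀ v ∈ V, ‖v‖ = 1 ∧ ‖t - ζ‖ ≤ ‖v - ζ‖ := by
  have hζ0 : ζ ≠ 0 := norm_ne_zero_iff.mp (by rw [hζ]; exact one_ne_zero)
  set θ := (-t / ζ).arg with hθ
  have hexp : Complex.exp (θ * Complex.I) = -t / ζ := by
    have h := Complex.norm_mul_exp_arg_mul_I (-t / ζ)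
    rwa [norm_div, norm_neg, ht, hζ, div_one, Complex.ofReal_one, one_mul] at h
  have hsq : ∀ x : ℝ, ‖-ζ * Complex.exp (x * Complex.I) - ζ‖ ^ 2 = 2 + 2 * Real.cos x := by
    intro x
    have h1 : -ζ * Complex.exp (x * Complex.I) - ζ = -ζ * (1 + Complex.exp (x * Complex.I)) := by
      ring
    rw [h1, norm_mul, norm_neg, hζ, one_mul, ← Complex.normSq_eq_norm_sq, Complex.normSq_apply]
    simp only [Complex.add_re, Complex.add_im, Complex.one_re, Complex.one_im,
      Complex.exp_ofReal_mul_I_re, Complex.exp_ofReal_mul_I_im]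
    nlinarith [Real.sin_sq_add_cos_sq x]
  have ht' : t = -ζ * Complex.exp (θ * Complex.I) := by rw [hexp]; field_simp
  refine ⟨(fun s : ℝ => -ζ * Complex.exp ((s * θ : ℝ) * Complex.I)) '' Icc 0 1,
    isPreconnected_Icc.image _ (by fun_prop), ⟨0, by simp, by simp⟩, ⟨1, by simp, ?_⟩, ?_⟩
  · simp only [one_mul]; exact ht'.symm
  · rintro _ ⟨s, ⟨hs0, hs1⟩, rfl⟩
    refine ⟨by simp only [norm_mul, norm_neg, hζ, Complex.norm_exp_ofReal_mul_I, one_mul], ?_⟩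
    refine le_of_sq_le_sq ?_ (norm_nonneg _)
    have e1 := hsq θ
    rw [← ht'] at e1
    rw [e1, hsq]
    have h2 : Real.cos θ ≤ Real.cos (s * θ) := by
      rw [← Real.cos_abs θ, ← Real.cos_abs (s * θ), abs_mul, abs_of_nonneg hs0]
      refine Real.cos_le_cos_of_nonneg_of_le_pi (by positivity) (Complex.abs_arg_le_pi _) ?_
      exact mul_le_of_le_one_left (abs_nonneg _) hs1
    linarith

theorem norm_ofReal_mul_sub {s : ℝ} (hs : 0 ≤ s) {v ζ : ℂ} (hv : ‖v‖ = 1) :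
    ‖(s : ℂ) * v‖ = s ∧ ‖(s : ℂ) * v - (‖(s : ℂ) * v‖ : ℝ) * ζ‖ = s * ‖v - ζ‖ := by
  have h : ‖(s : ℂ) * v‖ = s := by
    rw [norm_mul, hv, mul_one, Complex.norm_real, Real.norm_of_nonneg hs]
  refine ⟨h, ?_⟩
  rw [h, ← mul_sub, norm_mul, Complex.norm_real, Real.norm_of_nonneg hs]

theorem not_isBounded_ray {v : ℂ} (hv : ‖v‖ = 1) (s : ℝ) :
    ¬ Bornology.IsBounded ((fun x : ℝ => (x : ℂ) * v) '' Ici s) := by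
  intro h
  obtain ⟨C, hC⟩ := h.exists_norm_le
  have h1 := hC _ ⟨max s (|C| + 1), mem_Ici.mpr (le_max_left _ _), rfl⟩
  have h2 : 0 ≤ max s (|C| + 1) := le_max_of_le_right (by positivity)
  rw [(norm_ofReal_mul_sub (ζ := 0) h2 hv).1] at h1
  linarith [le_max_right s (|C| + 1), le_abs_self C]

theorem isPreconnected_ray (v : ℂ) (s : ℝ) :
    IsPreconnected ((fun x : ℝ => (x : ℂ) * v) '' Ici s) :=
  isPreconnected_Ici.image _ (by fun_prop)

/-! ### Approximation on a disc, a cone and an arc -/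

/-- The union of a smaller disc, a truncated cone around `ζ`, and the unit circle with an open arc
around `ξ` removed. -/
def discConeArc (ζ ξ : ℂ) (σ B d δ : ℝ) : Set ℂ :=
  {z | ‖z‖ ≤ σ} ∪ {z | ‖z‖ ≤ B ∧ ‖z - ‖z‖ * ζ‖ ≤ d * ‖z‖} ∪ {z | ‖z‖ = 1 ∧ δ ≤ ‖z - ξ‖}

section

variable {ζ ξ : ℂ} {σ B d δ : ℝ}

theorem isCompact_discConeArc : IsCompact (discConeArc ζ ξ σ B d δ) := by
  refine Metric.isCompact_of_isClosed_isBounded ?_ ?_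
  · have h₁ : IsClosed {z : ℂ | ‖z‖ ≤ σ} := isClosed_le (by fun_prop) (by fun_prop)
    have h₂ : IsClosed ({z : ℂ | ‖z‖ ≤ B} ∩ {z : ℂ | ‖z - ‖z‖ * ζ‖ ≤ d * ‖z‖}) :=
      (isClosed_le (by fun_prop) (by fun_prop)).inter (isClosed_le (by fun_prop) (by fun_prop))
    have h₃ : IsClosed ({z : ℂ | ‖z‖ = 1} ∩ {z : ℂ | δ ≤ ‖z - ξ‖}) :=
      (isClosed_eq (by fun_prop) (by fun_prop)).inter (isClosed_le (by fun_prop) (by fun_prop))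
    exact (h₁.union h₂).union h₃
  · refine isBounded_iff_forall_norm_le.mpr ⟨max σ (max B 1), ?_⟩
    rintro z ((h | h) | h)
    · exact le_max_of_le_left h
    · exact le_max_of_le_right (le_max_of_le_left h.1)
    · exact le_max_of_le_right (le_max_of_le_right h.1.le)

theorem ofReal_mul_notMem_discConeArc {s : ℝ} (hs0 : 0 < s) (hσ : σ < s) {v : ℂ} (hv : ‖v‖ = 1)
    (hd : d < ‖v - ζ‖) (hK : s = 1 → ‖v - ξ‖ < δ) :
    (s : ℂ) * v ∉ discConeArc ζ ξ σ B d δ := by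
  obtain ⟨h1, h2⟩ := norm_ofReal_mul_sub (ζ := ζ) hs0.le hv
  rintro ((h | h) | h)
  · exact absurd (h1.symm.trans_le h) hσ.not_ge
  · have h3 := h.2
    rw [h2, h1, mul_comm d] at h3
    exact absurd (le_of_mul_le_mul_left h3 hs0) hd.not_ge
  · obtain ⟨h3, h4⟩ := h
    rw [h1] at h3
    have := hK h3
    rw [h3, Complex.ofReal_one, one_mul] at h4
    linarith

/-- The pole leaves along its own ray, which is outside the circle and, by `hd`, outside the cone
even where the cone extends beyond the circle. -/
theorem polyApprox_inv_sub_outer (hσ : σ < 1) {t : ℂ} (ht : ‖t‖ = 1) (hd : d < ‖t - ζ‖) {s : ℝ}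
    (hs : 1 < s) : PolyApprox (discConeArc ζ ξ σ B d δ) (fun z => (s * t - z)⁻¹) := by
  refine PolyApprox.inv_sub isCompact_discConeArc (isPreconnected_ray t s) ?_
    (not_isBounded_ray ht s) ⟨s, self_mem_Ici, rfl⟩
  rw [Set.disjoint_left]
  rintro _ ⟨x, hx, rfl⟩
  have hx' : 1 < x := hs.trans_le hx
  exact ofReal_mul_notMem_discConeArc (by linarith) (hσ.trans hx') ht hd
    fun h => absurd h hx'.ne'

/-- The pole moves on the circle of radius `q` to `q * ξ` by way of `-ζ`, avoiding the cone, and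
then leaves along the ray of `ξ`, crossing the unit circle in the removed arc. -/
theorem polyApprox_inv_sub_inner (hζ : ‖ζ‖ = 1) (hξ : ‖ξ‖ = 1) (hξd : d < ‖ξ - ζ‖) (hδ : 0 < δ)
    {t : ℂ} (ht : ‖t‖ = 1) (hd : d < ‖t - ζ‖) {q : ℝ} (hq : 0 < q) (hq1 : q < 1) (hσ : σ < q) :
    PolyApprox (discConeArc ζ ξ σ B d δ) (fun z => (q * t - z)⁻¹) := by
  obtain ⟨V, hV, hVζ, hVt, hVn⟩ := exists_isPreconnected_arc hζ ht
  obtain ⟨W, hW, hWζ, hWξ, hWn⟩ := exists_isPreconnected_arc hζ hξ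
  set m : ℂ → ℂ := fun v => q * v
  have hm : Continuous m := by fun_prop
  have hVW : IsPreconnected (m '' (V ∪ W)) :=
    (hV.union (-ζ) hVζ hWζ hW).image m hm.continuousOn
  have hU : IsPreconnected (m '' (V ∪ W) ∪ (fun x : ℝ => (x : ℂ) * ξ) '' Ici q) :=
    hVW.union (q * ξ) ⟨ξ, Or.inr hWξ, rfl⟩ ⟨q, self_mem_Ici, rfl⟩ (isPreconnected_ray ξ q)
  refine PolyApprox.inv_sub isCompact_discConeArc hU ?_
    (fun h => not_isBounded_ray hξ q (h.subset subset_union_right))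
    (Or.inl ⟨t, Or.inl hVt, rfl⟩)
  rw [Set.disjoint_left]
  rintro _ (⟨v, hv, rfl⟩ | ⟨x, hx, rfl⟩)
  · have hv' : ‖v‖ = 1 ∧ d < ‖v - ζ‖ := by
      rcases hv with hv | hv
      · exact ⟨(hVn v hv).1, hd.trans_le (hVn v hv).2⟩
      · exact ⟨(hWn v hv).1, hξd.trans_le (hWn v hv).2⟩
    exact ofReal_mul_notMem_discConeArc hq hσ hv'.1 hv'.2 fun h => absurd h hq1.ne
  · exact ofReal_mul_notMem_discConeArc (hq.trans_le hx) (hσ.trans_le hx) hξ hξd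
      fun _ => by simpa using hδ

/-- A continuous function on the circle vanishing near `ζ` is approximable by polynomials off an
arc, with the polynomials small on a smaller disc and on a cone around `ζ`. -/
theorem exists_poly_approx_of_eq_zero_near (hζ : ‖ζ‖ = 1) (hξ : ‖ξ‖ = 1) {d₁ ε : ℝ} (hσ : σ < 1)
    (hd : d < d₁) (hξd : d₁ ≤ ‖ξ - ζ‖) (hδ : 0 < δ) (hε : 0 < ε) {ψ : ℂ → ℂ}
    (hψ : ContinuousOn ψ (sphere 0 1)) (hψ0 : ∀ t, ‖t‖ = 1 → ‖t - ζ‖ < d₁ → ψ t = 0) :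
    ∃ p : Polynomial ℂ, (∀ z, ‖z‖ ≤ σ → ‖p.eval z‖ ≤ ε) ∧
      (∀ z, ‖z‖ ≤ B → ‖z - ‖z‖ * ζ‖ ≤ d * ‖z‖ → ‖p.eval z‖ ≤ ε) ∧
      ∀ z, ‖z‖ = 1 → δ ≤ ‖z - ξ‖ → ‖p.eval z - ψ z‖ ≤ ε := by
  -- A lower bound for the distance from the support of `ψ` to the disc (`1 - σ`), to the part of
  -- the cone with `‖z‖ > 1 / 2` (`(d₁ - d) / 4`), and to the rest of the cone (`1 / 2`).
  set c : ℝ := min (1 - σ) (min ((d₁ - d) / 4) (1 / 2)) with hc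
  have hc0 : 0 < c := lt_min (by linarith) (lt_min (by linarith) (by norm_num))
  have hfar : ∀ s, ‖s‖ = 1 → ψ s ≠ 0 → d₁ ≤ ‖s - ζ‖ := fun s hs h =>
    not_lt.mp fun h' => h (hψ0 s hs h')
  have hnear := exists_sum_ratPoisson_approx hψ (B := max B 1) hc0 (half_pos hε)
  have hev : ∀ᶠ q : ℝ in 𝓝[<] 1, max σ 0 < q :=
    (eventually_gt_nhds (max_lt hσ one_pos)).filter_mono nhdsWithin_le_nhds
  obtain ⟨q, ⟨⟨N, t, ht, hcirc, hoff⟩, hqσ⟩, hq1⟩ := ((hnear.and hev).and self_mem_nhdsWithin).exists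
  replace hq1 : q < 1 := hq1
  have hq0 : 0 < q := (le_max_right _ _).trans_lt hqσ
  replace hqσ : σ < q := (le_max_left _ _).trans_lt hqσ
  have hPA : PolyApprox (discConeArc ζ ξ σ B d δ)
      (fun u => ∑ j ∈ Finset.range N, ψ (t j) / N * ratPoisson q (t j) u) := by
    refine PolyApprox.sum _ fun j _ => ?_
    by_cases h0 : ψ (t j) = 0
    · intro η hη
      exact ⟨0, fun z _ => by simpa [h0] using hη.le⟩
    · have hdj : d < ‖t j - ζ‖ := hd.trans_le (hfar _ (ht j) h0)
      have h1 := (polyApprox_inv_sub_outer (ξ := ξ) (B := B) (δ := δ) hσ (ht j) hdj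
        (one_lt_inv_iff₀.mpr ⟨hq0, hq1⟩)).const_mul (t j / q)
      have h2 := (polyApprox_inv_sub_inner (B := B) hζ hξ (hd.trans_le hξd) hδ (ht j) hdj hq0 hq1
        hqσ).const_mul (-(q * t j))
      have h3 : (fun u => ψ (t j) / N * ratPoisson q (t j) u)
          = fun u => ψ (t j) / N * (t j / q * (((q⁻¹ : ℝ) : ℂ) * t j - u)⁻¹
            + -(q * t j) * (q * t j - u)⁻¹) := by
        funext u
        rw [ratPoisson, Complex.ofReal_inv, inv_mul_eq_div]
        ring
      rw [h3]
      exact (h1.add h2).const_mul _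
  obtain ⟨p, hp⟩ := hPA (ε / 2) (half_pos hε)
  have hsmall : ∀ z ∈ discConeArc ζ ξ σ B d δ, ‖z‖ ≤ max B 1 →
      (∀ s, ‖s‖ = 1 → ψ s ≠ 0 → c ≤ ‖z - s‖) → ‖p.eval z‖ ≤ ε := by
    intro z hz hzB hzs
    have h1 := hp z hz
    have h2 := hoff z hzB hzs
    have h3 := norm_le_norm_sub_add (p.eval z)
      (∑ j ∈ Finset.range N, ψ (t j) / N * ratPoisson q (t j) z)
    linarith
  refine ⟨p, fun z hz => ?_, fun z hzB hz => ?_, fun z hz hzξ => ?_⟩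
  · refine hsmall z (Or.inl (Or.inl hz)) (le_max_of_le_right (hz.trans hσ.le)) fun s hs _ => ?_
    have h1 := norm_sub_norm_le s z
    rw [norm_sub_rev, hs] at h1
    exact (min_le_left _ _).trans (by linarith)
  · refine hsmall z (Or.inl (Or.inr ⟨hzB, hz⟩)) (le_max_of_le_left hzB) fun s hs h0 => ?_
    have hsd := hfar s hs h0
    by_cases ha : ‖z‖ ≤ 1 / 2
    · have h1 := norm_sub_norm_le s z
      rw [norm_sub_rev, hs] at h1
      exact (min_le_right _ _).trans ((min_le_right _ _).trans (by linarith))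
    · rw [not_le] at ha
      refine (min_le_right _ _).trans ((min_le_left _ _).trans ?_)
      have h1 : |‖z‖ - 1| ≤ ‖z - s‖ := by
        have := abs_norm_sub_norm_le z s
        rwa [hs] at this
      have h2 : ‖(‖z‖ : ℂ) * (s - ζ)‖ = ‖z‖ * ‖s - ζ‖ := by
        rw [norm_mul, Complex.norm_real, norm_norm]
      have h3 : ‖(1 - (‖z‖ : ℂ)) * s‖ = |‖z‖ - 1| := by
        rw [norm_mul, hs, mul_one, ← Complex.ofReal_one, ← Complex.ofReal_sub, Complex.norm_real,
          Real.norm_eq_abs, abs_sub_comm]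
      have h4 : (‖z‖ : ℂ) * (s - ζ) = (z - ‖z‖ * ζ) - ((z - s) + (1 - (‖z‖ : ℂ)) * s) := by ring
      have h5 := norm_sub_le (z - ‖z‖ * ζ) ((z - s) + (1 - (‖z‖ : ℂ)) * s)
      have h6 := norm_add_le (z - s) ((1 - (‖z‖ : ℂ)) * s)
      rw [← h4, h2] at h5
      rw [h3] at h6
      have h7 : ‖z‖ * d₁ ≤ ‖z‖ * ‖s - ζ‖ := by gcongr
      -- The inequalities combine to `‖z‖ * d₁ ≤ d * ‖z‖ + 2 * ‖z - s‖`, and `‖z‖ > 1 / 2`.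
      nlinarith
  · have h1 := hp z (Or.inr ⟨hz, hzξ⟩)
    have h2 := hcirc z hz
    have h3 := norm_sub_le_norm_sub_add_norm_sub (p.eval z)
      (∑ j ∈ Finset.range N, ψ (t j) / N * ratPoisson q (t j) z) (ψ z)
    linarith

end

/-! ### Correction polynomials and the inductive step -/

theorem eventually_norm_eval_dilate_sub_le (S : Polynomial ℂ) {ε : ℝ} (hε : 0 < ε) :
    ∀ᶠ s : ℝ in 𝓝[<] 1, ∀ z : ℂ, ‖z‖ = 1 → ‖S.eval (s * z) - S.eval z‖ ≤ ε := by
  have huc := (isCompact_closedBall (0 : ℂ) 1).uniformContinuousOn_of_continuous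
    S.continuous.continuousOn
  rw [Metric.uniformContinuousOn_iff] at huc
  obtain ⟨δ, hδ, h⟩ := huc ε hε
  have hev : ∀ᶠ s : ℝ in 𝓝[<] 1, max 0 (1 - δ) < s :=
    (eventually_gt_nhds (max_lt one_pos (by linarith))).filter_mono nhdsWithin_le_nhds
  filter_upwards [hev, self_mem_nhdsWithin] with s hs hs1 z hz
  replace hs1 : s < 1 := hs1
  have hs0 : 0 < s := (le_max_left _ _).trans_lt hs
  have hsδ : 1 - δ < s := (le_max_right _ _).trans_lt hs
  have h1 := (norm_ofReal_mul_sub (ζ := 0) hs0.le hz).1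
  have h2 : dist ((s : ℂ) * z) z < δ := by
    have e : (s : ℂ) * z - z = ((s - 1 : ℝ) : ℂ) * z := by push_cast; ring
    rw [dist_eq_norm, e, norm_mul, hz, mul_one, Complex.norm_real, Real.norm_eq_abs, abs_sub_comm,
      abs_of_pos (by linarith)]
    linarith
  have h3 := h _ (by rw [mem_closedBall_zero_iff, h1]; exact hs1.le) z (by simp [hz]) h2
  rw [dist_eq_norm] at h3
  exact h3.le

section

variable {A : Set ℂ} {ζ : ℂ}

theorem norm_eq_one_of_closure_inter (hA1 : closure A ∩ sphere (0 : ℂ) 1 = {ζ}) : ‖ζ‖ = 1 := by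
  have h : ζ ∈ closure A ∩ sphere (0 : ℂ) 1 := by rw [hA1]; rfl
  simpa using h.2

/-- The points of `closure A` outside the open cone form a compact set. It misses the circle,
because `ζ` lies inside the cone, so the norm has a maximum below 1 on it. -/
theorem exists_mem_cone_of_lt_norm (hA : A ⊆ ball (0 : ℂ) 1)
    (hA1 : closure A ∩ sphere (0 : ℂ) 1 = {ζ}) {d : ℝ} (hd : 0 < d) :
    ∃ σ < 1, ∀ z ∈ A, σ < ‖z‖ → ‖z - ‖z‖ * ζ‖ ≤ d * ‖z‖ := by
  have hcl : closure A ⊆ closedBall 0 1 := closure_minimal (hA.trans ball_subset_closedBall)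
    isClosed_closedBall
  have hf : IsClosed {z : ℂ | d * ‖z‖ ≤ ‖z - ‖z‖ * ζ‖} := isClosed_le (by fun_prop) (by fun_prop)
  have hc : IsCompact (closure A ∩ {z : ℂ | d * ‖z‖ ≤ ‖z - ‖z‖ * ζ‖}) :=
    ((isCompact_closedBall (0 : ℂ) 1).of_isClosed_subset isClosed_closure hcl).inter_right hf
  rcases Set.eq_empty_or_nonempty (closure A ∩ {z : ℂ | d * ‖z‖ ≤ ‖z - ‖z‖ * ζ‖}) with he | hne
  · refine ⟨0, one_pos, fun z hz _ => ?_⟩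
    by_contra h
    exact (he ▸ ⟨subset_closure hz, (not_le.mp h).le⟩ : z ∈ (∅ : Set ℂ)).elim
  · obtain ⟨z₀, ⟨hz₀A, hz₀⟩, hmax⟩ := hc.exists_isMaxOn hne continuous_norm.continuousOn
    refine ⟨‖z₀‖, lt_of_le_of_ne (by simpa using hcl hz₀A) fun h1 => ?_, fun z hz hlt => ?_⟩
    · have : z₀ ∈ closure A ∩ sphere (0 : ℂ) 1 := ⟨hz₀A, by simpa using h1⟩
      rw [hA1, mem_singleton_iff] at this
      subst this
      rw [mem_ofPred_eq, h1] at hz₀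
      simp at hz₀
      linarith
    · by_contra h
      exact hlt.not_ge (hmax ⟨subset_closure hz, (not_le.mp h).le⟩)

/-- Given `h` continuous on the circle and vanishing at `ζ`, there is a nearby function vanishing
in a neighbourhood of `ζ`. -/
theorem exists_approx_eq_zero_near {h : ℂ → ℂ} (hh : ContinuousOn h (sphere 0 1)) (hζ : ‖ζ‖ = 1)
    (hhζ : h ζ = 0) {ε κ : ℝ} (hε : 0 < ε) (hκ : 0 < κ) :
    ∃ (d : ℝ) (ψ : ℂ → ℂ), 0 < d ∧ d ≤ κ ∧ ContinuousOn ψ (sphere 0 1) ∧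
      (∀ t, ‖t - ζ‖ < d → ψ t = 0) ∧ ∀ t, ‖t‖ = 1 → ‖ψ t - h t‖ ≤ ε := by
  obtain ⟨δ, hδ, hδh⟩ := Metric.continuousWithinAt_iff.mp (hh ζ (by simpa using hζ)) ε hε
  have hd : 0 < min (δ / 2) κ := by positivity
  set d := min (δ / 2) κ with hd_def
  -- A cutoff equal to 0 within `d` of `ζ` and to 1 beyond `2 * d`; in between, `2 * d ≤ δ` makes
  -- `h` itself at most `ε`.
  set χ : ℂ → ℝ := fun t => min 1 (max 0 (‖t - ζ‖ / d - 1)) with hχ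
  have hχc : Continuous χ := by fun_prop
  refine ⟨d, fun t => χ t * h t, hd, min_le_right _ _,
    (Complex.continuous_ofReal.comp hχc).continuousOn.mul hh, fun t ht => ?_, fun t ht => ?_⟩
  · have h1 : ‖t - ζ‖ / d - 1 ≤ 0 := by
      rw [sub_nonpos, div_le_one hd]; exact ht.le
    simp [hχ, max_eq_left h1]
  · by_cases hfar : 2 * d ≤ ‖t - ζ‖
    · have h1 : 1 ≤ ‖t - ζ‖ / d - 1 := by
        rw [le_sub_iff_add_le, le_div_iff₀ hd]; linarith
      have h2 : χ t = 1 := by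
        simp only [hχ]
        rw [max_eq_right (zero_le_one.trans h1), min_eq_left h1]
      simp [h2, hε.le]
    · have h1 : dist t ζ < δ := by
        rw [dist_eq_norm]
        linarith [min_le_left (δ / 2) κ]
      have h2 := hδh (by simpa using ht) h1
      rw [hhζ, dist_zero_right] at h2
      have h3 : (χ t : ℂ) * h t - h t = ((χ t - 1 : ℝ) : ℂ) * h t := by push_cast; ring
      have h4 : |χ t - 1| ≤ 1 := by
        have h5 : 0 ≤ χ t := le_min zero_le_one (le_max_left _ _)
        have h6 : χ t ≤ 1 := min_le_left _ _
        rw [abs_le]; constructor <;> linarith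
      rw [h3, norm_mul, Complex.norm_real, Real.norm_eq_abs]
      nlinarith [norm_nonneg (h t)]

theorem exists_unimodular_ne_near (hζ : ‖ζ‖ = 1) {δ : ℝ} (hδ : 0 < δ) :
    ∃ ξ : ℂ, ‖ξ‖ = 1 ∧ ξ ≠ ζ ∧ ‖ξ - ζ‖ < δ := by
  have hc : Tendsto (fun x : ℝ => ζ * Complex.exp (x * Complex.I)) (𝓝[>] 0) (𝓝 ζ) := by
    have : Continuous fun x : ℝ => ζ * Complex.exp (x * Complex.I) := by fun_prop
    have h := this.tendsto 0
    simp only [Complex.ofReal_zero, zero_mul, Complex.exp_zero, mul_one] at h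
    exact h.mono_left nhdsWithin_le_nhds
  have hlt : ∀ᶠ x : ℝ in 𝓝[>] 0, x < Real.pi :=
    (eventually_lt_nhds Real.pi_pos).filter_mono nhdsWithin_le_nhds
  obtain ⟨x, ⟨hx, hxπ⟩, hx0⟩ :=
    (((Metric.tendsto_nhds.mp hc δ hδ).and hlt).and self_mem_nhdsWithin).exists
  replace hx0 : 0 < x := hx0
  have hζ0 : ζ ≠ 0 := norm_ne_zero_iff.mp (by rw [hζ]; exact one_ne_zero)
  refine ⟨ζ * Complex.exp (x * Complex.I),
    by rw [norm_mul, hζ, one_mul, Complex.norm_exp_ofReal_mul_I], fun h => ?_,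
    by rwa [dist_eq_norm] at hx⟩
  have h1 := mul_left_cancel₀ hζ0 (h.trans (mul_one ζ).symm)
  have h2 := congrArg Complex.im h1
  rw [Complex.exp_ofReal_mul_I_im, Complex.one_im] at h2
  exact (Real.sin_pos_of_pos_of_lt_pi hx0 hxπ).ne' h2

/-- A correction polynomial: small on a smaller disc, close to `g` on a dilated arc, and bounded
on `A` by a constant which depends neither on the disc nor on the dilation. -/
theorem eventually_exists_poly_correction_of_ne (hA : A ⊆ ball (0 : ℂ) 1)
    (hA1 : closure A ∩ sphere (0 : ℂ) 1 = {ζ}) {g : ℂ → ℂ} (hg : ContinuousOn g (sphere 0 1))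
    {ξ : ℂ} (hξ : ‖ξ‖ = 1) (hξζ : ξ ≠ ζ) {δ ρ ε : ℝ} (hδ : 0 < δ) (hρ0 : 0 ≤ ρ) (hρ : ρ < 1)
    (hε : 0 < ε) :
    ∀ᶠ s : ℝ in 𝓝[<] 1, ∃ p : Polynomial ℂ, (∀ z, ‖z‖ ≤ ρ → ‖p.eval z‖ ≤ ε) ∧
      (∀ z, ‖z‖ = 1 → δ ≤ ‖z - ξ‖ → ‖p.eval (s * z) - g z‖ ≤ ε) ∧
      ∀ z ∈ A, ‖p.eval z‖ ≤ ‖g ζ‖ + ε := by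
  have hζ := norm_eq_one_of_closure_inter hA1
  have hε4 : 0 < ε / 4 := by positivity
  obtain ⟨m, hm⟩ : ∃ m : ℕ, ‖g ζ‖ * ρ ^ m ≤ ε / 4 := by
    have h := (tendsto_pow_atTop_nhds_zero_of_lt_one hρ0 hρ).const_mul ‖g ζ‖
    rw [mul_zero] at h
    exact (h.eventually_le_const hε4).exists
  -- `Q` carries the value of `g` at `ζ`, where `A` touches the circle; this is the only part of the
  -- correction that need not be small on `A`.
  set Q : Polynomial ℂ :=
    Polynomial.C (g ζ) * (Polynomial.C ((starRingEnd ℂ) ζ) * Polynomial.X) ^ m with hQ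
  have hQe : ∀ z, Q.eval z = g ζ * ((starRingEnd ℂ) ζ * z) ^ m := fun z => by simp [hQ]
  have hQn : ∀ z, ‖Q.eval z‖ = ‖g ζ‖ * ‖z‖ ^ m := fun z => by
    rw [hQe, norm_mul, norm_pow, norm_mul, RCLike.norm_conj, hζ, one_mul]
  have hQζ : Q.eval ζ = g ζ := by
    rw [hQe, ← Complex.inv_eq_conj hζ, inv_mul_cancel₀, one_pow, mul_one]
    exact norm_ne_zero_iff.mp (by rw [hζ]; exact one_ne_zero)
  obtain ⟨d, ψ, hd, hdκ, hψ, hψ0, hψh⟩ := exists_approx_eq_zero_near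
    (h := fun z => g z - Q.eval z) (hg.sub Q.continuous.continuousOn) hζ (by simp [hQζ]) hε4
    (norm_pos_iff.mpr (sub_ne_zero.mpr hξζ))
  obtain ⟨σ₀, hσ₀, hcone⟩ := exists_mem_cone_of_lt_norm hA hA1 (half_pos hd)
  have hσ : max σ₀ ρ < 1 := max_lt hσ₀ hρ
  set σ := max σ₀ ρ with hσ_def
  have hev : ∀ᶠ s : ℝ in 𝓝[<] 1, σ < s :=
    (eventually_gt_nhds hσ).filter_mono nhdsWithin_le_nhds
  filter_upwards [hev, eventually_norm_eval_dilate_sub_le Q hε4] with s hs hQs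
  have hs0 : 0 < s := (hρ0.trans (le_max_right _ _)).trans_lt hs
  have hsc : (s : ℂ) ≠ 0 := by exact_mod_cast hs0.ne'
  -- `p` will be evaluated at `z / s`, so its disc has radius `σ / s < 1` and its cone reaches out
  -- to `1 / s > 1`. The cone condition is invariant under this scaling.
  obtain ⟨p, hp1, hp2, hp3⟩ := exists_poly_approx_of_eq_zero_near (B := 1 / s) hζ hξ
    ((div_lt_one hs0).mpr hs) (half_lt_self hd) hdκ hδ hε4 hψ fun t _ => hψ0 t
  have hnorm : ∀ z : ℂ, ‖(s : ℂ)⁻¹ * z‖ = ‖z‖ / s := fun z => by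
    rw [norm_mul, norm_inv, Complex.norm_real, Real.norm_of_nonneg hs0.le, inv_mul_eq_div]
  have hpe : ∀ z, (Q + p.comp (Polynomial.C (s : ℂ)⁻¹ * Polynomial.X)).eval z
      = Q.eval z + p.eval ((s : ℂ)⁻¹ * z) := fun z => by simp
  refine ⟨Q + p.comp (Polynomial.C (s : ℂ)⁻¹ * Polynomial.X), fun z hz => ?_,
    fun z hz hzξ => ?_, fun z hz => ?_⟩
  · rw [hpe]
    have h1 : ‖Q.eval z‖ ≤ ε / 4 := by
      rw [hQn]
      refine le_trans ?_ hm
      gcongr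
    have h2 := hp1 ((s : ℂ)⁻¹ * z) (by
      rw [hnorm]
      have : ‖z‖ ≤ σ := hz.trans (le_max_right _ _)
      gcongr)
    linarith [norm_add_le (Q.eval z) (p.eval ((s : ℂ)⁻¹ * z))]
  · rw [hpe, inv_mul_cancel_left₀ hsc]
    have e : Q.eval (s * z) + p.eval z - g z = (Q.eval (s * z) - Q.eval z)
        + ((p.eval z - ψ z) + (ψ z - (g z - Q.eval z))) := by ring
    rw [e]
    have h1 := norm_add_le (Q.eval (s * z) - Q.eval z)
      ((p.eval z - ψ z) + (ψ z - (g z - Q.eval z)))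
    have h2 := norm_add_le (p.eval z - ψ z) (ψ z - (g z - Q.eval z))
    linarith [hQs z hz, hp3 z hz hzξ, hψh z hz]
  · rw [hpe]
    have hz1 : ‖z‖ < 1 := by simpa using hA hz
    have h1 : ‖Q.eval z‖ ≤ ‖g ζ‖ := by
      rw [hQn]
      exact mul_le_of_le_one_right (norm_nonneg _) (pow_le_one₀ (norm_nonneg _) hz1.le)
    have h2 : ‖p.eval ((s : ℂ)⁻¹ * z)‖ ≤ ε / 4 := by
      by_cases hzσ : ‖z‖ ≤ σ
      · exact hp1 _ (by rw [hnorm]; gcongr)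
      · have hc := hcone z hz ((le_max_left _ _).trans_lt (not_le.mp hzσ))
        refine hp2 _ (by rw [hnorm]; gcongr) ?_
        have e : (s : ℂ)⁻¹ * z - (‖(s : ℂ)⁻¹ * z‖ : ℝ) * ζ = (s : ℂ)⁻¹ * (z - ‖z‖ * ζ) := by
          rw [hnorm]; push_cast; field_simp
        rw [e, hnorm, hnorm, ← mul_div_assoc]
        gcongr
    linarith [norm_add_le (Q.eval z) (p.eval ((s : ℂ)⁻¹ * z))]

theorem eventually_exists_poly_correction (hA : A ⊆ ball (0 : ℂ) 1)
    (hA1 : closure A ∩ sphere (0 : ℂ) 1 = {ζ}) {g : ℂ → ℂ} (hg : ContinuousOn g (sphere 0 1))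
    {ξ : ℂ} (hξ : ‖ξ‖ = 1) {δ ρ ε : ℝ} (hδ : 0 < δ) (hρ0 : 0 ≤ ρ) (hρ : ρ < 1) (hε : 0 < ε) :
    ∀ᶠ s : ℝ in 𝓝[<] 1, ∃ p : Polynomial ℂ, (∀ z, ‖z‖ ≤ ρ → ‖p.eval z‖ ≤ ε) ∧
      (∀ z, ‖z‖ = 1 → δ ≤ ‖z - ξ‖ → ‖p.eval (s * z) - g z‖ ≤ ε) ∧
      ∀ z ∈ A, ‖p.eval z‖ ≤ ‖g ζ‖ + ε := by
  by_cases hξζ : ξ = ζ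
  -- The gap cannot be centred at `ζ`, since the escape ray would run inside the cone. Moving the
  -- centre by less than `δ / 2` and halving the gap keeps the new arc inside the old one.
  · obtain ⟨ξ', hξ', hne, hlt⟩ :=
      exists_unimodular_ne_near (norm_eq_one_of_closure_inter hA1) (half_pos hδ)
    filter_upwards [eventually_exists_poly_correction_of_ne hA hA1 hg hξ' hne (half_pos hδ) hρ0 hρ
      hε] with s hs
    obtain ⟨p, h1, h2, h3⟩ := hs
    refine ⟨p, h1, fun z hz hzξ => h2 z hz ?_, h3⟩
    rw [hξζ] at hzξ
    linarith [norm_sub_le_norm_sub_add_norm_sub z ξ' ζ]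
  · exact eventually_exists_poly_correction_of_ne hA hA1 hg hξ hξζ hδ hρ0 hρ hε

theorem exists_poly_step {r : ℕ → ℝ} (hr_mem : ∀ n, r n ∈ Ico (0 : ℝ) 1)
    (hr_lim : Tendsto r atTop (𝓝 1)) {w : ℝ → ℝ} (hw_mono : MonotoneOn w (Ico (0 : ℝ) 1))
    (hw_lim : Tendsto w (𝓝[<] 1) atTop) (hA : A ⊆ ball (0 : ℂ) 1)
    (hA1 : closure A ∩ sphere (0 : ℂ) 1 = {ζ}) {S : Polynomial ℂ} {η : ℝ} (hη : 0 < η)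
    (hS : ∀ z ∈ A, ‖S.eval z‖ ≤ w ‖z‖ - 2 * η) (n : ℕ) {φ : ℂ → ℂ}
    (hφ : ContinuousOn φ (sphere 0 1)) {ξ : ℂ} (hξ : ‖ξ‖ = 1) {δ : ℝ} (hδ : 0 < δ) :
    ∃ (S' : Polynomial ℂ) (n' : ℕ), n < n' ∧ (∀ z, ‖z‖ ≤ r n → ‖S'.eval z - S.eval z‖ ≤ η) ∧
      (∀ z, ‖z‖ = 1 → δ ≤ ‖z - ξ‖ → ‖S'.eval (r n' * z) - φ z‖ ≤ η) ∧
      ∀ z ∈ A, ‖S'.eval z‖ ≤ w ‖z‖ - η := by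
  obtain ⟨C, hC⟩ := (isCompact_closedBall (0 : ℂ) 1).exists_bound_of_continuousOn
    S.continuous.continuousOn
  set g : ℂ → ℂ := fun z => φ z - S.eval z with hg
  have hη2 : 0 < η / 2 := half_pos hη
  have hr0 : max (r n) 0 < 1 := max_lt (hr_mem n).2 one_pos
  have hev : ∀ᶠ s : ℝ in 𝓝[<] 1, max (r n) 0 < s :=
    (eventually_gt_nhds hr0).filter_mono nhdsWithin_le_nhds
  -- `ρ` can be fixed before the dilation radius `r n'`, because the bound `‖g ζ‖ + η / 2` for the
  -- correction on `A` depends on neither.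
  obtain ⟨ρ, ⟨hρw, hρr⟩, hρ1⟩ := (((hw_lim.eventually_ge_atTop (C + (‖g ζ‖ + η / 2) + η)).and
    hev).and self_mem_nhdsWithin).exists
  replace hρ1 : ρ < 1 := hρ1
  have hρ0 : 0 ≤ ρ := (le_max_right _ _).trans hρr.le
  have hr_lim' : Tendsto r atTop (𝓝[<] 1) := tendsto_nhdsWithin_iff.mpr
    ⟨hr_lim, Eventually.of_forall fun k => (hr_mem k).2⟩
  have hgc : ContinuousOn g (sphere 0 1) := hφ.sub S.continuous.continuousOn
  have h := (eventually_exists_poly_correction hA hA1 hgc hξ hδ hρ0 hρ1 hη2).and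
    (eventually_norm_eval_dilate_sub_le S hη2)
  obtain ⟨n', ⟨⟨p, hp1, hp2, hp3⟩, hSn⟩, hn'⟩ :=
    ((hr_lim'.eventually h).and (eventually_gt_atTop n)).exists
  refine ⟨S + p, n', hn', fun z hz => ?_, fun z hz hzξ => ?_, fun z hz => ?_⟩
  · rw [Polynomial.eval_add, add_sub_cancel_left]
    exact (hp1 z (hz.trans ((le_max_left _ _).trans hρr.le))).trans (half_le_self hη.le)
  · have e : (S + p).eval (r n' * z) - φ z
        = (S.eval (r n' * z) - S.eval z) + (p.eval (r n' * z) - g z) := by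
      rw [Polynomial.eval_add, hg]; ring
    rw [e]
    linarith [norm_add_le (S.eval (r n' * z) - S.eval z) (p.eval (r n' * z) - g z), hSn z hz,
      hp2 z hz hzξ]
  · rw [Polynomial.eval_add]
    have h1 := norm_add_le (S.eval z) (p.eval z)
    by_cases hzρ : ‖z‖ ≤ ρ
    · linarith [hS z hz, hp1 z hzρ]
    · have hz1 : ‖z‖ < 1 := by simpa using hA hz
      rw [not_le] at hzρ
      have h2 := hw_mono ⟨hρ0, hρ1⟩ ⟨norm_nonneg z, hz1⟩ hzρ.le
      have h3 := hC z (by simpa using hz1.le)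
      linarith [hp3 z hz]

end

/-! ### Limit of the polynomials -/

/-- A sequence of polynomials whose increments are small on discs exhausting the unit disc converges
locally uniformly there. -/
theorem exists_limit_of_poly_increments {S : ℕ → Polynomial ℂ} {ρ : ℕ → ℝ} (hρ_mono : Monotone ρ)
    (hρ_lim : Tendsto ρ atTop (𝓝 1))
    (hS : ∀ k z, ‖z‖ ≤ ρ k → ‖(S (k + 1)).eval z - (S k).eval z‖ ≤ (1 / 2) ^ (k + 1)) :
    ∃ f : ℂ → ℂ, DifferentiableOn ℂ f (ball 0 1) ∧
      (∀ k z, ‖z‖ ≤ ρ k → ‖f z - (S k).eval z‖ ≤ (1 / 2) ^ k) ∧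
      ∀ z, ‖z‖ < 1 → Tendsto (fun k => (S k).eval z) atTop (𝓝 (f z)) := by
  have hgeo : ∀ s z, ‖z‖ ≤ ρ s → ∀ k, dist ((S (k + s)).eval z) ((S (k + 1 + s)).eval z)
      ≤ (1 / 2) ^ s / 2 / 2 ^ k := by
    intro s z hz k
    have h := hS (k + s) z (hz.trans (hρ_mono (Nat.le_add_left s k)))
    rw [dist_comm, dist_eq_norm, show k + 1 + s = k + s + 1 by ring]
    refine h.trans (le_of_eq ?_)
    rw [pow_succ, pow_add, one_div, inv_pow, inv_pow]
    field_simp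
  have hconv : ∀ z s, ‖z‖ ≤ ρ s → ∃ a, Tendsto (fun k => (S k).eval z) atTop (𝓝 a) := by
    intro z s hs
    obtain ⟨a, ha⟩ := cauchySeq_tendsto_of_complete (cauchySeq_of_le_geometric_two (hgeo s z hs))
    exact ⟨a, (tendsto_add_atTop_iff_nat (f := fun k => (S k).eval z) s).mp ha⟩
  have hlim : ∀ z s, ‖z‖ ≤ ρ s →
      Tendsto (fun k => (S k).eval z) atTop (𝓝 (limUnder atTop fun k => (S k).eval z)) :=
    fun z s hs => tendsto_nhds_limUnder (hconv z s hs)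
  have hexh : ∀ z : ℂ, ‖z‖ < 1 → ∃ s, ‖z‖ < ρ s := fun z hz =>
    (hρ_lim.eventually_const_lt hz).exists
  have hbound : ∀ k z, ‖z‖ ≤ ρ k →
      ‖(limUnder atTop fun k => (S k).eval z) - (S k).eval z‖ ≤ (1 / 2) ^ k := by
    intro k z hz
    have h := dist_le_of_le_geometric_two_of_tendsto₀ (hgeo k z hz)
      ((tendsto_add_atTop_iff_nat (f := fun j => (S j).eval z) k).mpr (hlim z k hz))
    rwa [zero_add, dist_comm, dist_eq_norm] at h
  refine ⟨fun z => limUnder atTop fun k => (S k).eval z, ?_, hbound, fun z hz => ?_⟩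
  · have hu : TendstoLocallyUniformlyOn (fun k z => (S k).eval z)
        (fun z => limUnder atTop fun k => (S k).eval z) atTop (ball 0 1) := by
      rw [Metric.tendstoLocallyUniformlyOn_iff]
      intro ε hε x hx
      obtain ⟨s, hs⟩ := hexh x (by simpa using hx)
      refine ⟨{z | ‖z‖ < ρ s}, mem_nhdsWithin_of_mem_nhds
        ((isOpen_lt continuous_norm continuous_const).mem_nhds hs), ?_⟩
      have hpow := (tendsto_pow_atTop_nhds_zero_of_lt_one (r := (1 / 2 : ℝ)) (by norm_num)
        (by norm_num)).eventually_lt_const hε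
      filter_upwards [hpow, eventually_ge_atTop s] with k hk hks y hy
      rw [dist_eq_norm]
      exact (hbound k y ((le_of_lt hy).trans (hρ_mono hks))).trans_lt hk
    exact hu.differentiableOn (Eventually.of_forall fun k => (S k).differentiable.differentiableOn)
      isOpen_ball
  · obtain ⟨s, hs⟩ := hexh z hz
    exact hlim z s hs.le

/-! ### Enumeration of the targets and the construction of `f` -/

theorem frequently_unpair_fst_eq (i : ℕ) : ∃ᶠ s in atTop, (Nat.unpair s).1 = i := by
  rw [frequently_atTop]
  exact fun a => ⟨Nat.pair i a, Nat.right_le_pair i a, by rw [Nat.unpair_pair]⟩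

/-- Countably many data on the circle, each an everywhere defined continuous function and a point,
which are dense among all such data. -/
theorem exists_dense_circle_data : ∃ (Φ : ℕ → ℂ → ℂ) (ξ : ℕ → ℂ), (∀ i, Continuous (Φ i)) ∧
    (∀ i, ‖ξ i‖ = 1) ∧ ∀ K : Set ℂ, IsCompact K → K ⊆ sphere (0 : ℂ) 1 → K ≠ sphere (0 : ℂ) 1 →
      ∀ φ : ℂ → ℂ, ContinuousOn φ K → ∀ ε > 0, ∃ i, ξ i ∉ K ∧ ∀ z ∈ K, ‖Φ i z - φ z‖ ≤ ε := by
  have hne : Nonempty (sphere (0 : ℂ) 1) := ⟨⟨1, by simp⟩⟩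
  have hext : ∀ f : C(sphere (0 : ℂ) 1, ℂ), ∃ F : C(ℂ, ℂ), F.restrict (sphere (0 : ℂ) 1) = f :=
    fun f => ContinuousMap.exists_restrict_eq isClosed_sphere f
  choose F hF using hext
  have hFz : ∀ f (z : sphere (0 : ℂ) 1), F f z = f z := fun f z => congrArg (· z) (hF f)
  -- The function and the gap point are enumerated jointly, so that one index can approximate `φ` on
  -- `K` and have its gap point off `K`.
  set D := TopologicalSpace.denseSeq (C(sphere (0 : ℂ) 1, ℂ) × sphere (0 : ℂ) 1)
  refine ⟨fun i => F (D i).1, fun i => (D i).2, fun i => (F (D i).1).continuous,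
    fun i => by simp, fun K hK hKs hKne φ hφ ε hε => ?_⟩
  obtain ⟨ξ₀, hξ₀, hξ₀K⟩ : ∃ ξ ∈ sphere (0 : ℂ) 1, ξ ∉ K := by
    by_contra! h
    exact hKne (hKs.antisymm h)
  obtain ⟨G, hG⟩ := ContinuousMap.exists_restrict_eq hK.isClosed ⟨K.domRestrict φ, hφ.domRestrict⟩
  have hGz : ∀ z ∈ K, G z = φ z := fun z hz => congrArg (· ⟨z, hz⟩) hG
  have hopen : IsOpen (ball (G.restrict (sphere (0 : ℂ) 1)) ε ×ˢ
      ((↑) ⁻¹' Kᶜ : Set (sphere (0 : ℂ) 1))) :=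
    isOpen_ball.prod (hK.isClosed.isOpen_compl.preimage continuous_subtype_val)
  obtain ⟨i, hi1, hi2⟩ := (TopologicalSpace.denseRange_denseSeq _).exists_mem_open hopen
    ⟨(G.restrict (sphere (0 : ℂ) 1), ⟨ξ₀, hξ₀⟩), mem_ball_self hε, hξ₀K⟩
  refine ⟨i, hi2, fun z hz => ?_⟩
  have h := (ContinuousMap.dist_apply_le_dist ⟨z, hKs hz⟩).trans (mem_ball.mp hi1).le
  rw [← hFz, dist_eq_norm] at h
  simpa [hGz z hz] using h

theorem theorem3p4
    (r : ℕ → ℝ) (hr_mem : ∀ n, r n ∈ Ico (0 : ℝ) 1) (hr_mono : Monotone r)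
    (hr_lim : Tendsto r atTop (𝓝 1))
    (w : ℝ → ℝ) (hw_one : ∀ t ∈ Ico (0 : ℝ) 1, 1 ≤ w t)
    (hw_cont : ContinuousOn w (Ico (0 : ℝ) 1)) (hw_mono : MonotoneOn w (Ico (0 : ℝ) 1))
    (hw_lim : Tendsto w (𝓝[<] 1) atTop)
    (A : Set ℂ) (hA : A ⊆ ball (0 : ℂ) 1)
    (hA_one : ∃ ζ : ℂ, closure A ∩ sphere (0 : ℂ) 1 = {ζ}) :
    ∃ f ∈ AbelUniversal r, ∀ z ∈ A, ‖f z‖ ≤ w ‖z‖ := by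
  obtain ⟨ζ, hA1⟩ := hA_one
  obtain ⟨Φ, ξ, hΦ, hξ, hdense⟩ := exists_dense_circle_data
  have hstep : ∀ (s : ℕ) (S : Polynomial ℂ) (n : ℕ), ∃ (S' : Polynomial ℂ) (n' : ℕ),
      (∀ z ∈ A, ‖S.eval z‖ ≤ w ‖z‖ - (1 / 2) ^ s) → n < n' ∧
      (∀ z, ‖z‖ ≤ r n → ‖S'.eval z - S.eval z‖ ≤ (1 / 2) ^ (s + 1)) ∧
      -- `s.unpair.1` takes every value infinitely often, so each target recurs with gaps `1 / (s +
      -- 1)` tending to 0.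
      (∀ z, ‖z‖ = 1 → 1 / ((s : ℝ) + 1) ≤ ‖z - ξ s.unpair.1‖ →
        ‖S'.eval (r n' * z) - Φ s.unpair.1 z‖ ≤ (1 / 2) ^ (s + 1)) ∧
      ∀ z ∈ A, ‖S'.eval z‖ ≤ w ‖z‖ - (1 / 2) ^ (s + 1) := by
    intro s S n
    by_cases hS : ∀ z ∈ A, ‖S.eval z‖ ≤ w ‖z‖ - (1 / 2) ^ s
    · obtain ⟨S', n', h⟩ := exists_poly_step hr_mem hr_lim hw_mono hw_lim hA hA1
        (η := (1 / 2) ^ (s + 1)) (by positivity)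
        (fun z hz => (hS z hz).trans (le_of_eq (by rw [pow_succ]; ring))) n
        (hΦ s.unpair.1).continuousOn (hξ s.unpair.1) (δ := 1 / ((s : ℝ) + 1)) (by positivity)
      exact ⟨S', n', fun _ => h⟩
    -- An arbitrary value: the invariant is a premise inside the existential so that `choose` yields
    -- total functions to iterate.
    · exact ⟨0, 0, fun h => absurd h hS⟩
  choose F G hFG using hstep
  let x : ℕ → Polynomial ℂ × ℕ := fun s =>
    Nat.rec (0, 0) (fun s y => (F s y.1 y.2, G s y.1 y.2)) s
  have hinv : ∀ s, ∀ z ∈ A, ‖(x s).1.eval z‖ ≤ w ‖z‖ - (1 / 2) ^ s := by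
    intro s
    induction s with
    | zero =>
      -- The start is the zero polynomial with slack `(1 / 2) ^ 0 = 1`, which is where `1 ≤ w`
      -- enters.
      intro z hz
      have h := hw_one ‖z‖ ⟨norm_nonneg z, by simpa using hA hz⟩
      simpa [x] using h
    | succ s ih => exact (hFG s (x s).1 (x s).2 ih).2.2.2
  have hx := fun s => hFG s (x s).1 (x s).2 (hinv s)
  have hn_mono : StrictMono fun s => (x s).2 := strictMono_nat_of_lt_succ fun s => (hx s).1
  obtain ⟨f, hf_diff, hf_bound, hf_lim⟩ := exists_limit_of_poly_increments
    (S := fun s => (x s).1) (ρ := fun s => r (x s).2) (hr_mono.comp hn_mono.monotone)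
    (hr_lim.comp hn_mono.tendsto_atTop) fun s => (hx s).2.1
  refine ⟨f, ⟨hf_diff, fun K hK hKs hKne φ hφ => ?_⟩, fun z hz => ?_⟩
  · have hstage : ∀ (s : ℕ) (z : ℂ), ‖z‖ = 1 → 1 / ((s : ℝ) + 1) ≤ ‖z - ξ s.unpair.1‖ →
        ‖f (r (x (s + 1)).2 * z) - Φ s.unpair.1 z‖ ≤ (1 / 2) ^ s := by
      intro s z hz hzξ
      have h1 := (hx s).2.2.1 z hz hzξ
      have h2 := hf_bound (s + 1) (r (x (s + 1)).2 * z)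
        (norm_ofReal_mul_sub (ζ := 0) (hr_mem _).1 hz).1.le
      have h3 := norm_sub_le_norm_sub_add_norm_sub (f (r (x (s + 1)).2 * z))
        ((x (s + 1)).1.eval (r (x (s + 1)).2 * z)) (Φ s.unpair.1 z)
      have h4 : ((1 : ℝ) / 2) ^ s = (1 / 2) ^ (s + 1) + (1 / 2) ^ (s + 1) := by
        rw [pow_succ]; ring
      rw [h4]
      exact h3.trans (add_le_add h2 h1)
    have hfreq : ∀ k : ℕ, ∃ᶠ s in atTop, ∀ z ∈ K,
        ‖f (r (x (s + 1)).2 * z) - φ z‖ ≤ 2 * (1 / ((k : ℝ) + 1)) := by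
      intro k
      have hk : 0 < 1 / ((k : ℝ) + 1) := by positivity
      obtain ⟨i, hiK, hi⟩ := hdense K hK hKs hKne φ hφ _ hk
      obtain ⟨δ, hδ, hball⟩ := Metric.isOpen_iff.mp hK.isClosed.isOpen_compl (ξ i) hiK
      have hev1 := tendsto_one_div_add_atTop_nhds_zero_nat.eventually_lt_const hδ
      have hev2 := (tendsto_pow_atTop_nhds_zero_of_lt_one (r := (1 / 2 : ℝ)) (by norm_num)
        (by norm_num)).eventually_lt_const hk
      refine ((frequently_unpair_fst_eq i).and_eventually (hev1.and hev2)).mono ?_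
      rintro s ⟨rfl, hs1, hs2⟩ z hz
      -- The ball of radius `δ` about the gap point misses `K`, so once `1 / (s + 1) < δ` the
      -- removed arc does too.
      have hzξ : δ ≤ ‖z - ξ s.unpair.1‖ := by
        by_contra! h
        exact hball (by rwa [mem_ball, dist_eq_norm]) hz
      have h1 := hstage s z (by simpa using hKs hz) (hs1.le.trans hzξ)
      have h2 := norm_sub_le_norm_sub_add_norm_sub (f (r (x (s + 1)).2 * z))
        (Φ s.unpair.1 z) (φ z)
      linarith [hi z hz]
    obtain ⟨e, he, hek⟩ := extraction_forall_of_frequently hfreq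
    refine ⟨fun k => (x (e k + 1)).2, fun a b hab => hn_mono (Nat.succ_lt_succ (he hab)), ?_⟩
    rw [Metric.tendstoUniformlyOn_iff]
    intro ε hε
    have hlim := (tendsto_one_div_add_atTop_nhds_zero_nat (𝕜 := ℝ)).const_mul 2
    rw [mul_zero] at hlim
    filter_upwards [hlim.eventually_lt_const hε] with k hk z hz
    rw [dist_comm, dist_eq_norm]
    exact (hek k z hz).trans_lt hk
  · refine le_of_tendsto (hf_lim z (by simpa using hA hz)).norm (Eventually.of_forall fun s => ?_)
    have h : (0 : ℝ) < (1 / 2) ^ s := by positivity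
    linarith [hinv s z hz]
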